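/- Let $\mathbb{Q}(q^{1/2})$ be the field of rational functions in an indeterminate $q^{1/2}$, and let $\mathbb{Q}(q^{1/2})_{q^2}[[x,y]]$ be the skew formal power series ring in $x,y$ with relation $xy=q^2yx$, whose elements are the formal series $\sum_{a,b\ge 0}c_{a,b}x^ay^b$ with $c_{a,b}\in\mathbb{Q}(q^{1/2})$, with the topology of coefficientwise convergence (each coefficient eventually constant). Let $$\Phi(z)=\sum_{n\ge 0}\frac{q^{n/2}z^n}{(1-q)(1-q^2)\cdots(1-q^n)}$$ be the quantum dilogarithm, which may be evaluated at any $z$ without constant term. Theorem. In $\mathbb{Q}(q^{1/2})_{q^2}[[x,y]]$, we have $$\Phi(x)\Phi(y)=\Phi(y)\,\Phi(q^{-2}xy^2)\,\Phi(q^{-6}x^2y^3)\,\Phi(q^{-12}x^3y^4)\cdots$$ $$\cdot\;\Phi(q^{-1/2}xy)^{-1}\,\Phi(q^{-3/2}xy)^{-1}\;\cdot$$ $$\cdots\Phi(q^{-12}x^4y^3)\,\Phi(q^{-6}x^3y^2)\,\Phi(q^{-2}x^2y)\,\Phi(x).$$ That is: the partial products $$L_n=\Phi(y)\,\Phi(q^{-2}xy^2)\cdots\Phi(q^{-(n-1)n}x^{n-1}y^{n}),\qquad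 R_n=\Phi(q^{-(n-1)n}x^{n}y^{n-1})\cdots\Phi(q^{-2}x^2y)\,\Phi(x)$$ converge to elements $L$ and $R$ respectively as $n\to\infty$, the elements $\Phi(q^{-1/2}xy)$ and $\Phi(q^{-3/2}xy)$ are invertible, and $$\Phi(x)\Phi(y)=L\cdot\Phi(q^{-1/2}xy)^{-1}\,\Phi(q^{-3/2}xy)^{-1}\cdot R .$$ -/

import Mathlib

open Filter Topology

noncomputable section

namespace WildDilog

/-- The coefficient field `ℚ(q^{1/2})`: rational functions over `ℚ` in the indeterminate
`q^{1/2}`. -/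
abbrev Coef : Type := RatFunc ℚ

/-- The indeterminate `q^{1/2}`. -/
def qh : Coef := RatFunc.X

/-- The element `q = (q^{1/2})^2`. -/
def q : Coef := qh ^ 2

theorem qh_ne_zero : qh ≠ 0 := RatFunc.X_ne_zero

theorem q_ne_zero : q ≠ 0 := pow_ne_zero 2 qh_ne_zero

/-- The skew formal power series ring `ℚ(q^{1/2})_{q^m}[[x,y]]` with `x y = q^m y x`.
The function `f` stands for the formal series `∑_{a,b} f (a, b) x^a y^b`. -/
def SkewPowerSeries (_m : ℕ) : Type := ℕ × ℕ → Coef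

namespace SkewPowerSeries

variable {m : ℕ}

/-- The coefficient of `x^a y^b`. -/
def coeff (a b : ℕ) (f : SkewPowerSeries m) : Coef := f (a, b)

@[ext]
theorem ext {f g : SkewPowerSeries m} (h : ∀ a b, coeff a b f = coeff a b g) : f = g :=
  funext fun p => h p.1 p.2

instance : AddCommGroup (SkewPowerSeries m) := inferInstanceAs (AddCommGroup (ℕ × ℕ → Coef))

instance : Module Coef (SkewPowerSeries m) := inferInstanceAs (Module Coef (ℕ × ℕ → Coef))

/-- The monomial `x^a y^b` with coefficient `c`. -/
def monomial (a b : ℕ) (c : Coef) : SkewPowerSeries m := fun p => if p = (a, b) then c else 0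

instance : One (SkewPowerSeries m) := ⟨monomial 0 0 1⟩

/-- Multiplication, determined by
`(x^i y^j) (x^k y^l) = q^{-m j k} x^{i+k} y^{j+l}`. -/
instance : Mul (SkewPowerSeries m) :=
  ⟨fun f g p => ∑ s ∈ Finset.HasAntidiagonal.antidiagonal p.1, ∑ t ∈ Finset.HasAntidiagonal.antidiagonal p.2,
    (q ^ (m * (t.1 * s.2)))⁻¹ * (f (s.1, t.1) * g (s.2, t.2))⟩

@[simp] theorem coeff_zero (a b : ℕ) : coeff a b (0 : SkewPowerSeries m) = 0 := rfl

@[simp] theorem coeff_add (a b : ℕ) (f g : SkewPowerSeries m) :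
    coeff a b (f + g) = coeff a b f + coeff a b g := rfl

@[simp] theorem coeff_smul (a b : ℕ) (c : Coef) (f : SkewPowerSeries m) :
    coeff a b (c • f) = c * coeff a b f := rfl

theorem coeff_monomial (a b i j : ℕ) (c : Coef) :
    coeff a b (monomial i j c : SkewPowerSeries m) = if a = i ∧ b = j then c else 0 := by
  simp [coeff, monomial]

theorem coeff_one (a b : ℕ) :
    coeff a b (1 : SkewPowerSeries m) = if a = 0 ∧ b = 0 then 1 else 0 :=
  coeff_monomial a b 0 0 1

theorem coeff_mul (a b : ℕ) (f g : SkewPowerSeries m) :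
    coeff a b (f * g) = ∑ s ∈ Finset.HasAntidiagonal.antidiagonal a, ∑ t ∈ Finset.HasAntidiagonal.antidiagonal b,
      (q ^ (m * (t.1 * s.2)))⁻¹ * (coeff s.1 t.1 f * coeff s.2 t.2 g) := rfl

protected theorem one_mul (f : SkewPowerSeries m) : 1 * f = f := by
  ext a b
  rw [coeff_mul, Finset.sum_eq_single (0, a), Finset.sum_eq_single (0, b)]
  · simp [coeff_one]
  · rintro ⟨i, j⟩ h hne
    have : i ≠ 0 := by
      rintro rfl
      simp_all
    simp [coeff_one, this]
  · simp
  · rintro ⟨i, j⟩ h hne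
    have : i ≠ 0 := by
      rintro rfl
      simp_all
    simp [coeff_one, this]
  · simp

protected theorem mul_one (f : SkewPowerSeries m) : f * 1 = f := by
  ext a b
  rw [coeff_mul, Finset.sum_eq_single (a, 0), Finset.sum_eq_single (b, 0)]
  · simp [coeff_one]
  · rintro ⟨i, j⟩ h hne
    have : j ≠ 0 := by
      rintro rfl
      simp_all
    simp [coeff_one, this]
  · simp
  · rintro ⟨i, j⟩ h hne
    have : j ≠ 0 := by
      rintro rfl
      simp_all
    simp [coeff_one, this]
  · simp

/-- Reindexing of triple sums `i + j + k = n`. -/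
theorem sum_antidiagonal_triple (n : ℕ) (F : ℕ → ℕ → ℕ → Coef) :
    ∑ s ∈ Finset.HasAntidiagonal.antidiagonal n, ∑ t ∈ Finset.HasAntidiagonal.antidiagonal s.1, F t.1 t.2 s.2 =
      ∑ s ∈ Finset.HasAntidiagonal.antidiagonal n, ∑ t ∈ Finset.HasAntidiagonal.antidiagonal s.2, F s.1 t.1 t.2 := by
  simp only [Finset.sum_sigma']
  refine Finset.sum_nbij' (fun p => ⟨(p.2.1, p.2.2 + p.1.2), (p.2.2, p.1.2)⟩)
    (fun p => ⟨(p.1.1 + p.2.1, p.2.2), (p.1.1, p.2.1)⟩) ?_ ?_ ?_ ?_ ?_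
  all_goals
    rintro ⟨⟨i, j⟩, ⟨k, l⟩⟩ h
    simp only [Finset.mem_sigma, Finset.HasAntidiagonal.mem_antidiagonal] at h ⊢
  · exact ⟨by omega, trivial⟩
  · exact ⟨by omega, trivial⟩
  · simp [h.2]
  · simp [h.2]

protected theorem mul_assoc (f g h : SkewPowerSeries m) : f * g * h = f * (g * h) := by
  ext a b
  simp only [coeff_mul, Finset.mul_sum, Finset.sum_mul]
  refine (Finset.sum_congr rfl fun s _ => Finset.sum_comm).trans ?_
  refine Eq.trans ?_ (Finset.sum_congr rfl fun s _ => Finset.sum_comm).symm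
  refine Eq.trans ?_ (sum_antidiagonal_triple a fun i j k =>
    ∑ t ∈ Finset.HasAntidiagonal.antidiagonal b,
      ∑ u ∈ Finset.HasAntidiagonal.antidiagonal t.2,
        (q ^ (m * (t.1 * (j + k))))⁻¹ * (coeff i t.1 f *
          ((q ^ (m * (u.1 * k)))⁻¹ * (coeff j u.1 g * coeff k u.2 h)))) |>.trans ?_
  · refine Finset.sum_congr rfl fun s _ => Finset.sum_congr rfl fun s' hs' => ?_
    refine Eq.trans ?_ (sum_antidiagonal_triple b fun i j k =>
      (q ^ (m * (i * (s'.2 + s.2))))⁻¹ * (coeff s'.1 i f *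
          ((q ^ (m * (j * s.2)))⁻¹ * (coeff s'.2 j g * coeff s.2 k h))))
    refine Finset.sum_congr rfl fun t _ => Finset.sum_congr rfl fun t' ht' => ?_
    rw [← Finset.HasAntidiagonal.mem_antidiagonal.1 ht']
    rw [show m * ((t'.1 + t'.2) * s.2) = m * (t'.1 * s.2) + m * (t'.2 * s.2) by ring,
      show m * (t'.1 * (s'.2 + s.2)) = m * (t'.1 * s'.2) + m * (t'.1 * s.2) by ring,
      pow_add, pow_add, mul_inv, mul_inv]
    ring
  · refine Finset.sum_congr rfl fun s _ => Finset.sum_congr rfl fun s' hs' => ?_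
    rw [← Finset.HasAntidiagonal.mem_antidiagonal.1 hs']

instance : Ring (SkewPowerSeries m) where
  __ := (inferInstance : AddCommGroup (SkewPowerSeries m))
  one_mul := SkewPowerSeries.one_mul
  mul_one := SkewPowerSeries.mul_one
  mul_assoc := SkewPowerSeries.mul_assoc
  zero_mul f := by ext a b; simp [coeff_mul]
  mul_zero f := by ext a b; simp [coeff_mul]
  left_distrib f g h := by ext a b; simp [coeff_mul, mul_add, Finset.sum_add_distrib]
  right_distrib f g h := by ext a b; simp [coeff_mul, add_mul, mul_add, Finset.sum_add_distrib]

instance : Algebra Coef (SkewPowerSeries m) :=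
  Algebra.ofModule
    (fun c f g => by
      ext a b
      simp only [coeff_mul, coeff_smul, Finset.mul_sum]
      exact Finset.sum_congr rfl fun _ _ => Finset.sum_congr rfl fun _ _ => by ring)
    (fun c f g => by
      ext a b
      simp only [coeff_mul, coeff_smul, Finset.mul_sum]
      exact Finset.sum_congr rfl fun _ _ => Finset.sum_congr rfl fun _ _ => by ring)

/-- The variable `x`. -/
def x (m : ℕ) : SkewPowerSeries m := monomial 1 0 1

/-- The variable `y`. -/
def y (m : ℕ) : SkewPowerSeries m := monomial 0 1 1

theorem monomial_mul_monomial (a b c d : ℕ) (r s : Coef) :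
    (monomial a b r * monomial c d s : SkewPowerSeries m) =
      monomial (a + c) (b + d) ((q ^ (m * (b * c)))⁻¹ * (r * s)) := by
  ext i j
  rw [coeff_mul, coeff_monomial]
  split_ifs with hij
  · obtain ⟨rfl, rfl⟩ := hij
    rw [Finset.sum_eq_single (a, c), Finset.sum_eq_single (b, d)]
    · simp [coeff_monomial]
    · rintro ⟨k, l⟩ h hne
      have : ¬ (k = b ∧ l = d) := by simpa using hne
      simp only [coeff_monomial]
      grind
    · simp
    · rintro ⟨k, l⟩ h hne
      have : ¬ (k = a ∧ l = c) := by simpa using hne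
      refine Finset.sum_eq_zero fun t _ => ?_
      simp only [coeff_monomial]
      grind
    · simp
  · refine Finset.sum_eq_zero fun s hs => Finset.sum_eq_zero fun t ht => ?_
    rw [Finset.HasAntidiagonal.mem_antidiagonal] at hs ht
    simp only [coeff_monomial]
    grind

/-- The defining relation `x y = q^m y x`. -/
theorem x_mul_y : x m * y m = q ^ m • (y m * x m) := by
  have hq : q ^ m ≠ 0 := pow_ne_zero m q_ne_zero
  simp only [x, y, monomial_mul_monomial]
  ext a b
  rw [coeff_smul, coeff_monomial, coeff_monomial]
  split_ifs <;> simp_all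

theorem x_pow_mul_y_pow (a b : ℕ) : x m ^ a * y m ^ b = monomial a b 1 := by
  have hx : ∀ n : ℕ, x m ^ n = monomial n 0 1 := by
    intro n
    induction n with
    | zero => rfl
    | succ n ih => rw [pow_succ, ih, x, monomial_mul_monomial]; simp
  have hy : ∀ n : ℕ, y m ^ n = monomial 0 n 1 := by
    intro n
    induction n with
    | zero => rfl
    | succ n ih => rw [pow_succ, ih, y, monomial_mul_monomial]; simp
  rw [hx, hy, monomial_mul_monomial]
  simp

/-- The topology of coefficientwise convergence, each coefficient being eventually constant:
the product topology of the discrete topology on the coefficient field. -/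
instance : TopologicalSpace (SkewPowerSeries m) :=
  @Pi.topologicalSpace (ℕ × ℕ) (fun _ => Coef) (fun _ => ⊥)

instance : T2Space (SkewPowerSeries m) := by
  let _ : TopologicalSpace Coef := ⊥
  have : DiscreteTopology Coef := ⟨rfl⟩
  exact inferInstanceAs (T2Space (ℕ × ℕ → Coef))

theorem tendsto_iff {ι : Type*} {l : Filter ι} {f : ι → SkewPowerSeries m}
    {g : SkewPowerSeries m} :
    Tendsto f l (𝓝 g) ↔ ∀ a b, ∀ᶠ i in l, coeff a b (f i) = coeff a b g := by
  let _ : TopologicalSpace Coef := ⊥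
  have : DiscreteTopology Coef := ⟨rfl⟩
  have h := tendsto_pi_nhds (f := fun i => (f i : ℕ × ℕ → Coef)) (g := g) (u := l)
  refine h.trans ?_
  simp only [nhds_discrete, tendsto_pure, Prod.forall]
  rfl

/-- The value `∑_n φ_n u^n` of a one-variable power series `φ` at a skew power series `u`
without constant term. As `u^n` has no terms of total degree less than `n`, the terms with
`n > a + b` do not contribute to the coefficient of `x^a y^b`. -/
def evalAt (φ : PowerSeries Coef) (u : SkewPowerSeries m) : SkewPowerSeries m :=
  fun p => ∑ n ∈ Finset.range (p.1 + p.2 + 1), PowerSeries.coeff n φ * coeff p.1 p.2 (u ^ n)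

theorem coeff_pow_eq_zero {u : SkewPowerSeries m} (hu : coeff 0 0 u = 0) (n a b : ℕ)
    (h : a + b < n) : coeff a b (u ^ n) = 0 := by
  induction n generalizing a b with
  | zero => omega
  | succ n ih =>
    rw [pow_succ, coeff_mul]
    refine Finset.sum_eq_zero fun s hs => Finset.sum_eq_zero fun t ht => ?_
    rw [Finset.HasAntidiagonal.mem_antidiagonal] at hs ht
    by_cases h0 : s.2 = 0 ∧ t.2 = 0
    · rw [h0.1, h0.2, hu]; simp
    · rw [ih s.1 t.1 (by omega)]; simp

/-- `evalAt φ u` is the sum of the convergent series `∑_n φ_n u^n`. -/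
theorem hasSum_evalAt (φ : PowerSeries Coef) {u : SkewPowerSeries m} (hu : coeff 0 0 u = 0) :
    HasSum (fun n : ℕ => PowerSeries.coeff n φ • u ^ n) (evalAt φ u) := by
  rw [HasSum, tendsto_iff]
  intro a b
  have key : ∀ S : Finset ℕ, coeff a b (∑ n ∈ S, PowerSeries.coeff n φ • u ^ n) =
      ∑ n ∈ S, PowerSeries.coeff n φ * coeff a b (u ^ n) := by
    intro S
    induction S using Finset.cons_induction with
    | empty => rfl
    | cons n S hn ih => rw [Finset.sum_cons, Finset.sum_cons, coeff_add, ih, coeff_smul]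
  rw [SummationFilter.unconditional_filter]
  filter_upwards [eventually_ge_atTop (Finset.range (a + b + 1))] with S hS
  rw [key]
  refine (Finset.sum_subset hS fun n _ hn => ?_).symm
  rw [coeff_pow_eq_zero hu n a b (by simpa using hn), mul_zero]

end SkewPowerSeries

/-- The quantum dilogarithm `Φ(z) = ∑_{n ≥ 0} q^{n/2} z^n / ((1 - q) ⋯ (1 - q^n))`, as a
one-variable formal power series. -/
def quantumDilog : PowerSeries Coef :=
  PowerSeries.mk fun n => qh ^ n / ∏ i ∈ Finset.range n, (1 - q ^ (i + 1))

/-- `Φ(u)` for a skew power series `u` without constant term. -/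
def Phi {m : ℕ} (u : SkewPowerSeries m) : SkewPowerSeries m :=
  SkewPowerSeries.evalAt quantumDilog u

open SkewPowerSeries in
/-- The partial product
`Φ(y) Φ(q^{-2} x y^2) Φ(q^{-6} x^2 y^3) ⋯ Φ(q^{-(n-1)n} x^{n-1} y^n)`. -/
def leftPartialProd (n : ℕ) : SkewPowerSeries 2 :=
  ((List.range n).map fun k =>
    Phi ((q ^ (k * (k + 1)))⁻¹ • (x 2 ^ k * y 2 ^ (k + 1)))).prod

open SkewPowerSeries in
/-- The partial product
`Φ(q^{-(n-1)n} x^n y^{n-1}) ⋯ Φ(q^{-6} x^3 y^2) Φ(q^{-2} x^2 y) Φ(x)`. -/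
def rightPartialProd (n : ℕ) : SkewPowerSeries 2 :=
  ((List.range n).reverse.map fun k =>
    Phi ((q ^ (k * (k + 1)))⁻¹ • (x 2 ^ (k + 1) * y 2 ^ k))).prod

end WildDilog

end

/-!
Write `X_{(a, b)} = q^{-ab} x^a y^b` for the Weyl-ordered monomials, so that
`X_u X_p = q^{det (u, p)} X_{u + p}`, and `w = X_{(1, 1)}`. The factors of the identity are
`Φ(X_{(k, k + 1)})`, `Φ(X_{(k + 1, k)})`, `Φ(q^{1/2} w)⁻¹` and `Φ(q^{-1/2} w)⁻¹`. Products are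
compared by checking that both sides solve the same first-order `q`-difference equation with the
same initial part; the equations themselves are checked on Weyl-ordered coefficients.

The right-hand infinite product has a closed form. Let `c_n` be the coefficients of `Φ` and `e_m`
those of `∏_{i ≥ 0} (1 - q^i z) = Φ(q^{-1/2} z)⁻¹`, and put
`N_k = ∑_{n, m} c_n e_m q^m X_{n (k + 1, k) + m (1, 1)}` (`tailSeries k`). Then
`N_k = N_{k + 1} Φ(X_{(k + 1, k)})` (`tailSeries_eq_succ_mul`), hence `N_0 = N_n R_n` for the
partial product `R_n`. As `n → ∞` only the terms of `N_n` on the diagonal survive in a given degree, and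
their sum is `Φ(q^{1/2} w)⁻¹` (`coeff_tailSeries_of_lt`, `diagonalPhi_mul_eulerProd`). So `R_n`
converges to `Φ(q^{1/2} w) N_0`, and the anti-automorphism `swap` exchanging `x` and `y` shows that
`L_n` converges to `swap N_0 * Φ(q^{1/2} w)`.

Since `Φ(q^{-1/2} w)⁻¹ = (1 - w) Φ(q^{1/2} w)⁻¹`, the right-hand side of the theorem collapses to
`swap N_0 * (1 - w) * N_0`. Under `x ↦ q x` this series gets multiplied on the left by
`1 - q^{1/2} x`, just like `Φ(x) Φ(y)`, and both have the part `Φ(y)` free of `x`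
(`Phi_x_mul_Phi_y`).
-/

noncomputable section

namespace WildDilog

/-! ### Powers of `q` and the two coefficient sequences -/

theorem q_pow_ne_one {n : ℕ} (hn : n ≠ 0) : q ^ n ≠ 1 := by
  intro h
  have h2 : (algebraMap (Polynomial ℚ) (RatFunc ℚ)) (Polynomial.X ^ (2 * n)) =
      algebraMap (Polynomial ℚ) (RatFunc ℚ) 1 := by
    rw [map_pow, RatFunc.algebraMap_X, map_one, pow_mul]
    exact h
  have h3 := congrArg Polynomial.natDegree (RatFunc.algebraMap_injective ℚ h2)
  rw [Polynomial.natDegree_X_pow, Polynomial.natDegree_one] at h3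
  omega

theorem q_zpow_eq_one_iff {n : ℤ} : q ^ n = 1 ↔ n = 0 := by
  refine ⟨fun h => ?_, fun h => by rw [h, zpow_zero]⟩
  by_contra hn
  rcases Int.natAbs_eq n with h' | h' <;> rw [h'] at h
  · rw [zpow_natCast] at h
    exact q_pow_ne_one (Int.natAbs_ne_zero.2 hn) h
  · rw [zpow_neg, inv_eq_one, zpow_natCast] at h
    exact q_pow_ne_one (Int.natAbs_ne_zero.2 hn) h

theorem one_sub_q_pow_ne_zero (n : ℕ) : 1 - q ^ (n + 1) ≠ 0 :=
  sub_ne_zero.2 (q_pow_ne_one n.succ_ne_zero).symm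

theorem coeff_quantumDilog_zero : PowerSeries.coeff 0 quantumDilog = 1 := by
  simp [quantumDilog]

theorem coeff_quantumDilog_succ (n : ℕ) :
    PowerSeries.coeff (n + 1) quantumDilog * (1 - q ^ (n + 1)) =
      qh * PowerSeries.coeff n quantumDilog := by
  have h := one_sub_q_pow_ne_zero n
  have h' : ∏ i ∈ Finset.range n, (1 - q ^ (i + 1)) ≠ 0 :=
    Finset.prod_ne_zero_iff.2 fun i _ => one_sub_q_pow_ne_zero i
  simp only [quantumDilog, PowerSeries.coeff_mk, Finset.prod_range_succ]
  field_simp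
  ring

/-- The coefficient of `z ^ n` in `Φ(z)`, extended by zero to negative `n`. -/
def dilogCoeff (n : ℤ) : Coef := if 0 ≤ n then PowerSeries.coeff n.toNat quantumDilog else 0

/-- The coefficient of `z ^ n` in `∏_{i ≥ 0} (1 - q^i z)`, which by Euler's formula is
`(-1)^n q^{n(n-1)/2} / ((1 - q) ⋯ (1 - q^n))`, extended by zero to negative `n`. -/
def eulerCoeff (n : ℤ) : Coef :=
  if 0 ≤ n then ∏ i ∈ Finset.range n.toNat, (-q ^ i / (1 - q ^ (i + 1))) else 0

theorem dilogCoeff_of_neg {n : ℤ} (h : n < 0) : dilogCoeff n = 0 := if_neg (by omega)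

theorem eulerCoeff_of_neg {n : ℤ} (h : n < 0) : eulerCoeff n = 0 := if_neg (by omega)

theorem dilogCoeff_natCast (n : ℕ) : dilogCoeff n = PowerSeries.coeff n quantumDilog := by
  simp [dilogCoeff]

theorem dilogCoeff_zero : dilogCoeff 0 = 1 := by
  simp [dilogCoeff, coeff_quantumDilog_zero]

theorem eulerCoeff_zero : eulerCoeff 0 = 1 := by
  simp [eulerCoeff]

theorem dilogCoeff_sub_one (n : ℤ) :
    dilogCoeff (n - 1) = qh⁻¹ * (1 - q ^ n) * dilogCoeff n := by
  have := qh_ne_zero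
  rcases lt_trichotomy n 0 with h | rfl | h
  · rw [dilogCoeff_of_neg h, dilogCoeff_of_neg (by omega), mul_zero]
  · rw [dilogCoeff_of_neg (by omega)]
    simp
  · obtain ⟨k, rfl⟩ : ∃ k : ℕ, n = (k + 1 : ℕ) := ⟨(n - 1).toNat, by omega⟩
    rw [show ((k + 1 : ℕ) : ℤ) - 1 = (k : ℕ) by push_cast; ring, dilogCoeff_natCast,
      dilogCoeff_natCast, zpow_natCast]
    have := coeff_quantumDilog_succ k
    field_simp
    linear_combination -this

theorem eulerCoeff_sub_one (n : ℤ) :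
    eulerCoeff (n - 1) = -q * (q ^ n)⁻¹ * (1 - q ^ n) * eulerCoeff n := by
  have hq := q_ne_zero
  rcases lt_trichotomy n 0 with h | rfl | h
  · rw [eulerCoeff_of_neg h, eulerCoeff_of_neg (by omega), mul_zero]
  · rw [eulerCoeff_of_neg (by omega)]
    simp
  · obtain ⟨k, rfl⟩ : ∃ k : ℕ, n = (k + 1 : ℕ) := ⟨(n - 1).toNat, by omega⟩
    have := one_sub_q_pow_ne_zero k
    rw [show ((k + 1 : ℕ) : ℤ) - 1 = (k : ℕ) by push_cast; ring, eulerCoeff, eulerCoeff,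
      if_pos (by positivity), if_pos (by positivity), Int.toNat_natCast, Int.toNat_natCast,
      Finset.prod_range_succ, zpow_natCast]
    field_simp
    ring

namespace SkewPowerSeries

/-! ### Scaling, swapping, and truncation -/

variable {m : ℕ}

theorem coeff_sub (a b : ℕ) (f g : SkewPowerSeries m) :
    coeff a b (f - g) = coeff a b f - coeff a b g := rfl

theorem coeff_sum {ι : Type*} (S : Finset ι) (F : ι → SkewPowerSeries m) (a b : ℕ) :
    coeff a b (∑ i ∈ S, F i) = ∑ i ∈ S, coeff a b (F i) := by
  induction S using Finset.cons_induction with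
  | empty => rfl
  | cons n S hn ih => rw [Finset.sum_cons, Finset.sum_cons, coeff_add, ih]

/-- The ring endomorphism `x ↦ q^r x`, `y ↦ q^s y`. -/
def scale (r s : ℤ) : SkewPowerSeries m →+* SkewPowerSeries m where
  toFun f p := q ^ (r * p.1 + s * p.2) * f p
  map_one' := by
    ext a b
    change q ^ (r * a + s * b) * coeff a b 1 = coeff a b 1
    rw [coeff_one]
    split_ifs with h
    · simp [h.1, h.2]
    · simp
  map_zero' := by
    ext a b
    exact mul_zero _
  map_add' f g := by
    ext a b
    exact mul_add _ _ _
  map_mul' f g := by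
    ext a b
    change q ^ (r * a + s * b) * coeff a b (f * g) = _
    rw [coeff_mul, Finset.mul_sum]
    refine (Finset.sum_congr rfl fun i hi => ?_).trans (coeff_mul a b _ _).symm
    rw [Finset.mul_sum]
    refine Finset.sum_congr rfl fun j hj => ?_
    rw [Finset.HasAntidiagonal.mem_antidiagonal] at hi hj
    change _ = _ * ((q ^ (r * i.1 + s * j.1) * coeff i.1 j.1 f) *
      (q ^ (r * i.2 + s * j.2) * coeff i.2 j.2 g))
    rw [← hi, ← hj, show r * ((i.1 + i.2 : ℕ) : ℤ) + s * ((j.1 + j.2 : ℕ) : ℤ) =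
      (r * i.1 + s * j.1) + (r * i.2 + s * j.2) by push_cast; ring, zpow_add₀ q_ne_zero]
    ring

theorem coeff_scale (r s : ℤ) (f : SkewPowerSeries m) (a b : ℕ) :
    coeff a b (scale r s f) = q ^ (r * a + s * b) * coeff a b f := rfl

theorem scale_smul (r s : ℤ) (c : Coef) (f : SkewPowerSeries m) :
    scale r s (c • f) = c • scale r s f := by
  ext a b
  rw [coeff_smul, coeff_scale, coeff_scale, coeff_smul]
  ring

/-- The anti-automorphism exchanging `x` and `y`. -/
def swap (f : SkewPowerSeries m) : SkewPowerSeries m := fun p => f p.swap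

theorem coeff_swap (f : SkewPowerSeries m) (a b : ℕ) : coeff a b (swap f) = coeff b a f := rfl

theorem swap_one : swap (1 : SkewPowerSeries m) = 1 := by
  ext a b
  rw [coeff_swap, coeff_one, coeff_one]
  simp only [and_comm]

theorem swap_mul (f g : SkewPowerSeries m) : swap (f * g) = swap g * swap f := by
  ext a b
  rw [coeff_swap, coeff_mul, coeff_mul, Finset.sum_comm, ← Finset.Nat.sum_antidiagonal_swap]
  refine Finset.sum_congr rfl fun i _ => ?_
  rw [← Finset.Nat.sum_antidiagonal_swap]
  refine Finset.sum_congr rfl fun j _ => ?_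
  simp only [Prod.fst_swap, Prod.snd_swap, coeff_swap, mul_comm i.2 j.1,
    mul_comm (coeff j.2 i.2 f)]

theorem swap_pow (f : SkewPowerSeries m) (n : ℕ) : swap (f ^ n) = swap f ^ n := by
  induction n with
  | zero => rw [pow_zero, pow_zero, swap_one]
  | succ n ih => rw [pow_succ, swap_mul, ih, ← pow_succ']

theorem coeff_mul_congr_right {a b : ℕ} (f : SkewPowerSeries m) {g g' : SkewPowerSeries m}
    (h : ∀ s ≤ a, ∀ t ≤ b, coeff s t g = coeff s t g') :
    coeff a b (f * g) = coeff a b (f * g') := by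
  rw [coeff_mul, coeff_mul]
  refine Finset.sum_congr rfl fun i hi => Finset.sum_congr rfl fun j hj => ?_
  rw [Finset.HasAntidiagonal.mem_antidiagonal] at hi hj
  rw [h i.2 (by omega) j.2 (by omega)]

theorem coeff_mul_congr_left {a b : ℕ} {f f' : SkewPowerSeries m} (g : SkewPowerSeries m)
    (h : ∀ s ≤ a, ∀ t ≤ b, coeff s t f = coeff s t f') :
    coeff a b (f * g) = coeff a b (f' * g) := by
  rw [coeff_mul, coeff_mul]
  refine Finset.sum_congr rfl fun i hi => Finset.sum_congr rfl fun j hj => ?_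
  rw [Finset.HasAntidiagonal.mem_antidiagonal] at hi hj
  rw [h i.1 (by omega) j.1 (by omega)]

/-! ### Values of the quantum dilogarithm -/

theorem coeff_Phi (u : SkewPowerSeries m) (a b : ℕ) : coeff a b (Phi u) =
    ∑ n ∈ Finset.range (a + b + 1), PowerSeries.coeff n quantumDilog * coeff a b (u ^ n) := rfl

theorem coeff_Phi_of_lt {u : SkewPowerSeries m} (hu : coeff 0 0 u = 0) {a b K : ℕ}
    (h : a + b < K) : coeff a b (Phi u) =
      coeff a b (∑ n ∈ Finset.range K, PowerSeries.coeff n quantumDilog • u ^ n) := by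
  rw [coeff_sum, coeff_Phi]
  simp only [coeff_smul]
  refine Finset.sum_subset (Finset.range_mono (by omega)) fun n _ hn => ?_
  rw [coeff_pow_eq_zero hu n a b (by simpa using hn), mul_zero]

theorem scale_Phi (r s : ℤ) (u : SkewPowerSeries m) : scale r s (Phi u) = Phi (scale r s u) := by
  ext a b
  rw [coeff_scale, coeff_Phi, coeff_Phi, Finset.mul_sum]
  refine Finset.sum_congr rfl fun n _ => ?_
  rw [← map_pow, coeff_scale]
  ring

theorem swap_Phi (u : SkewPowerSeries m) : swap (Phi u) = Phi (swap u) := by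
  ext a b
  rw [coeff_swap, coeff_Phi, coeff_Phi, add_comm b a]
  refine Finset.sum_congr rfl fun n _ => ?_
  rw [← swap_pow, coeff_swap]

theorem commute_Phi {u : SkewPowerSeries m} (hu : coeff 0 0 u = 0) : Commute u (Phi u) := by
  ext a b
  have h : ∀ s ≤ a, ∀ t ≤ b, _ := fun s hs t ht =>
    coeff_Phi_of_lt hu (a := s) (b := t) (K := a + b + 1) (by omega)
  rw [coeff_mul_congr_right u h, coeff_mul_congr_left u h]
  refine congrArg _ (Commute.sum_right _ _ _ fun n _ => ?_)
  exact ((Commute.refl u).pow_right n).smul_right _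

/-- The functional equation of `Φ`, from `c_n (1 - q^n) = q^{1/2} c_{n-1}` for its coefficients. -/
theorem Phi_q_smul {u : SkewPowerSeries m} (hu : coeff 0 0 u = 0) :
    Phi (q • u) = (1 - qh • u) * Phi u := by
  ext a b
  rw [sub_mul, one_mul, smul_mul_assoc, coeff_sub, coeff_smul,
    coeff_Phi_of_lt (u := q • u) (by rw [coeff_smul, hu, mul_zero]) (K := a + b + 1 + 1) (by omega),
    coeff_Phi_of_lt hu (K := a + b + 1 + 1) (by omega),
    coeff_mul_congr_right u (fun s hs t ht =>
      coeff_Phi_of_lt hu (a := s) (b := t) (K := a + b + 1) (by omega)), ← coeff_smul, ← coeff_sub]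
  congr 1
  rw [Finset.sum_range_succ' _ (a + b + 1), Finset.sum_range_succ' _ (a + b + 1), Finset.mul_sum,
    Finset.smul_sum, add_sub_right_comm, ← Finset.sum_sub_distrib]
  congr 1
  refine Finset.sum_congr rfl fun n _ => ?_
  rw [smul_pow, smul_smul, mul_smul_comm, ← pow_succ', smul_smul, ← sub_smul]
  congr 1
  linear_combination -coeff_quantumDilog_succ n

theorem Phi_q_smul' {u : SkewPowerSeries m} (hu : coeff 0 0 u = 0) :
    Phi (q • u) = Phi u * (1 - qh • u) := by
  rw [Phi_q_smul hu]
  exact ((Commute.one_left _).sub_left ((commute_Phi hu).smul_left _)).eq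

theorem coeff_zero_zero_Phi (u : SkewPowerSeries m) : coeff 0 0 (Phi u) = 1 := by
  rw [coeff_Phi, Finset.sum_range_one, coeff_quantumDilog_zero, pow_zero, coeff_one]
  simp

theorem monomial_pow (i j : ℕ) (r : Coef) (n : ℕ) :
    ∃ s, (monomial i j r : SkewPowerSeries m) ^ n = monomial (n * i) (n * j) s := by
  induction n with
  | zero => exact ⟨1, by rw [zero_mul, zero_mul]; rfl⟩
  | succ n ih =>
    obtain ⟨s, hs⟩ := ih
    rw [pow_succ, hs, monomial_mul_monomial, ← Nat.succ_mul, ← Nat.succ_mul]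
    exact ⟨_, rfl⟩

/-- `Φ` of a monomial is supported on the multiples of its exponent. -/
theorem coeff_Phi_monomial_eq_zero {i j a b : ℕ} (r : Coef) (h : ∀ n, ¬(a = n * i ∧ b = n * j)) :
    coeff a b (Phi (monomial i j r : SkewPowerSeries m)) = 0 := by
  rw [coeff_Phi]
  refine Finset.sum_eq_zero fun n _ => ?_
  obtain ⟨s, hs⟩ := monomial_pow (m := m) i j r n
  rw [hs, coeff_monomial, if_neg (h n), mul_zero]

theorem coeff_zero_Phi_y (b : ℕ) :
    coeff 0 b (Phi (y m)) = PowerSeries.coeff b quantumDilog := by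
  have h (n : ℕ) : y m ^ n = monomial 0 n 1 := by
    rw [← x_pow_mul_y_pow, pow_zero, one_mul]
  simp only [coeff_Phi, h, coeff_monomial]
  simp

/-! ### Weyl-ordered coefficients -/

/-- The Weyl-ordered monomial `q^{-ij} x^i y^j`. For `u = (i, j)` and `p = (a, b)` one has
`X_u X_p = q^{ib - ja} X_{u + p}`. -/
def weylMonomial (i j : ℕ) : SkewPowerSeries 2 := monomial i j (q ^ (i * j))⁻¹

/-- The coefficient of `weylMonomial a b` in `f`, extended by zero to exponents in `ℤ × ℤ`. -/
def weyl (f : SkewPowerSeries 2) (a b : ℤ) : Coef :=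
  if 0 ≤ a ∧ 0 ≤ b then q ^ (a * b) * coeff a.toNat b.toNat f else 0

/-- The series with Weyl-ordered coefficients `g`; values of `g` outside `ℕ × ℕ` are ignored. -/
def ofWeyl (g : ℤ → ℤ → Coef) : SkewPowerSeries 2 := fun p => q ^ (-((p.1 : ℤ) * p.2)) * g p.1 p.2

theorem weyl_natCast (f : SkewPowerSeries 2) (a b : ℕ) :
    weyl f a b = q ^ ((a : ℤ) * b) * coeff a b f := by
  simp [weyl]

theorem weyl_of_neg (f : SkewPowerSeries 2) {a b : ℤ} (h : a < 0 ∨ b < 0) : weyl f a b = 0 :=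
  if_neg (by omega)

theorem coeff_eq_weyl (f : SkewPowerSeries 2) (a b : ℕ) :
    coeff a b f = q ^ (-((a : ℤ) * b)) * weyl f a b := by
  rw [weyl_natCast, ← mul_assoc, ← zpow_add₀ q_ne_zero, neg_add_cancel, zpow_zero, _root_.one_mul]

theorem coeff_eq_zero_iff (f : SkewPowerSeries 2) (a b : ℕ) :
    coeff a b f = 0 ↔ weyl f a b = 0 := by
  rw [weyl_natCast, mul_eq_zero, or_iff_right (zpow_ne_zero _ q_ne_zero)]

theorem ext_weyl {f g : SkewPowerSeries 2} (h : ∀ a b, weyl f a b = weyl g a b) : f = g := by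
  ext a b
  rw [coeff_eq_weyl, coeff_eq_weyl, h]

theorem weyl_ofWeyl {g : ℤ → ℤ → Coef} (hg : ∀ a b, a < 0 ∨ b < 0 → g a b = 0) (a b : ℤ) :
    weyl (ofWeyl g) a b = g a b := by
  by_cases h : 0 ≤ a ∧ 0 ≤ b
  · obtain ⟨⟨a, rfl⟩, ⟨b, rfl⟩⟩ := And.intro (Int.eq_ofNat_of_zero_le h.1)
      (Int.eq_ofNat_of_zero_le h.2)
    rw [weyl_natCast]
    change _ * (q ^ (-((a : ℤ) * b)) * g a b) = _
    rw [← mul_assoc, ← zpow_add₀ q_ne_zero, add_neg_cancel, zpow_zero, _root_.one_mul]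
  · rw [weyl_of_neg _ (by omega), hg a b (by omega)]

theorem weyl_sub (f g : SkewPowerSeries 2) (a b : ℤ) :
    weyl (f - g) a b = weyl f a b - weyl g a b := by
  unfold weyl
  split_ifs
  · rw [coeff_sub, mul_sub]
  · rw [sub_zero]

theorem weyl_smul (c : Coef) (f : SkewPowerSeries 2) (a b : ℤ) :
    weyl (c • f) a b = c * weyl f a b := by
  unfold weyl
  split_ifs
  · rw [coeff_smul]; ring
  · rw [mul_zero]

theorem weyl_scale (r s : ℤ) (f : SkewPowerSeries 2) (a b : ℤ) :
    weyl (scale r s f) a b = q ^ (r * a + s * b) * weyl f a b := by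
  unfold weyl
  split_ifs with h
  · rw [coeff_scale, Int.toNat_of_nonneg h.1, Int.toNat_of_nonneg h.2]; ring
  · rw [mul_zero]

theorem weyl_swap (f : SkewPowerSeries 2) (a b : ℤ) : weyl (swap f) a b = weyl f b a := by
  unfold weyl
  rw [coeff_swap, mul_comm a b]
  simp only [and_comm]

theorem coeff_monomial_mul (i j a b : ℕ) (r : Coef) (f : SkewPowerSeries 2) :
    coeff (i + a) (j + b) (monomial i j r * f) = (q ^ (2 * (j * a)))⁻¹ * (r * coeff a b f) := by
  rw [coeff_mul, Finset.sum_eq_single (i, a), Finset.sum_eq_single (j, b)]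
  · simp [coeff_monomial]
  · rintro ⟨k, l⟩ h hne
    rw [Finset.HasAntidiagonal.mem_antidiagonal] at h
    have : k ≠ j := by grind
    simp [coeff_monomial, this]
  · simp
  · rintro ⟨k, l⟩ h hne
    rw [Finset.HasAntidiagonal.mem_antidiagonal] at h
    have : k ≠ i := by grind
    simp [coeff_monomial, this]
  · simp

theorem coeff_monomial_mul_of_lt {i j a b : ℕ} (r : Coef) (f : SkewPowerSeries 2)
    (h : a < i ∨ b < j) : coeff a b (monomial i j r * f) = 0 := by
  rw [coeff_mul]
  refine Finset.sum_eq_zero fun s hs => Finset.sum_eq_zero fun t ht => ?_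
  rw [Finset.HasAntidiagonal.mem_antidiagonal] at hs ht
  rw [coeff_monomial, if_neg (by omega), zero_mul, mul_zero]

theorem weyl_weylMonomial_mul (i j : ℕ) (f : SkewPowerSeries 2) (a b : ℤ) :
    weyl (weylMonomial i j * f) a b = q ^ (i * b - j * a) * weyl f (a - i) (b - j) := by
  by_cases h : 0 ≤ a ∧ 0 ≤ b
  · obtain ⟨⟨a, rfl⟩, ⟨b, rfl⟩⟩ := And.intro (Int.eq_ofNat_of_zero_le h.1)
      (Int.eq_ofNat_of_zero_le h.2)
    by_cases h' : i ≤ a ∧ j ≤ b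
    · obtain ⟨⟨a, rfl⟩, ⟨b, rfl⟩⟩ := And.intro (Nat.exists_eq_add_of_le h'.1)
        (Nat.exists_eq_add_of_le h'.2)
      rw [weyl_natCast, weylMonomial, coeff_monomial_mul, Nat.cast_add, Nat.cast_add,
        add_sub_cancel_left, add_sub_cancel_left, weyl_natCast, ← zpow_natCast, ← zpow_natCast,
        ← zpow_neg, ← zpow_neg, ← mul_assoc, ← mul_assoc, ← mul_assoc,
        ← mul_assoc, ← zpow_add₀ q_ne_zero, ← zpow_add₀ q_ne_zero, ← zpow_add₀ q_ne_zero]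
      congr 2
      push_cast
      ring
    · rw [weyl_of_neg f (by omega), mul_zero, ← coeff_eq_zero_iff]
      exact coeff_monomial_mul_of_lt _ f (by omega)
  · rw [weyl_of_neg _ (by omega), weyl_of_neg f (by omega), mul_zero]

theorem swap_weylMonomial (i j : ℕ) : swap (weylMonomial i j) = weylMonomial j i := by
  ext a b
  rw [coeff_swap, weylMonomial, weylMonomial, coeff_monomial, coeff_monomial, mul_comm i j]
  simp only [and_comm]

theorem weyl_mul_weylMonomial (i j : ℕ) (f : SkewPowerSeries 2) (a b : ℤ) :
    weyl (f * weylMonomial i j) a b = q ^ (j * a - i * b) * weyl f (a - i) (b - j) := by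
  have h : f * weylMonomial i j = swap (weylMonomial j i * swap f) := by
    rw [swap_mul, swap_weylMonomial]; rfl
  rw [h, weyl_swap, weyl_weylMonomial_mul, weyl_swap]

theorem weylMonomial_eq_smul (i j : ℕ) :
    weylMonomial i j = (q ^ (i * j))⁻¹ • (x 2 ^ i * y 2 ^ j) := by
  rw [x_pow_mul_y_pow]
  ext a b
  rw [coeff_smul, weylMonomial, coeff_monomial, coeff_monomial]
  split_ifs <;> simp

theorem x_eq_weylMonomial : x 2 = weylMonomial 1 0 := by
  simp [x, weylMonomial]

theorem scale_weylMonomial (r s : ℤ) (i j : ℕ) :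
    scale r s (weylMonomial i j) = q ^ (r * i + s * j) • weylMonomial i j := by
  ext a b
  rw [coeff_scale, coeff_smul, weylMonomial, coeff_monomial]
  split_ifs with h
  · rw [h.1, h.2]
  · rw [mul_zero, mul_zero]

theorem coeff_zero_zero_weylMonomial {i j : ℕ} (h : i + j ≠ 0) :
    coeff 0 0 (weylMonomial i j) = 0 := by
  rw [weylMonomial, coeff_monomial, if_neg (by omega)]

/-! ### Uniqueness of solutions of `q`-difference equations -/

/-- A series is determined by its part without `x` and by its behaviour under `x ↦ q x`. -/
theorem eq_of_scale_x {f g : SkewPowerSeries 2}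
    (hf : scale 1 0 f = (1 - qh • x 2) * f) (hg : scale 1 0 g = (1 - qh • x 2) * g)
    (h0 : ∀ b, coeff 0 b f = coeff 0 b g) : f = g := by
  rw [← sub_eq_zero]
  set d := f - g with hd
  have hd1 : scale 1 0 d = d - qh • (weylMonomial 1 0 * d) := by
    rw [hd, map_sub, hf, hg, ← mul_sub, sub_mul, one_mul, smul_mul_assoc, x_eq_weylMonomial]
  have key : ∀ a : ℕ, ∀ b, weyl d a b = 0 := by
    intro a
    induction a with
    | zero =>
      intro b
      by_cases hb : 0 ≤ b
      · lift b to ℕ using hb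
        rw [← coeff_eq_zero_iff, hd, coeff_sub, h0, sub_self]
      · exact weyl_of_neg _ (by omega)
    | succ a ih =>
      intro b
      have h := congrArg (weyl · ((a + 1 : ℕ) : ℤ) b) hd1
      simp only [weyl_scale, weyl_sub, weyl_smul, weyl_weylMonomial_mul] at h
      rw [show ((a + 1 : ℕ) : ℤ) - (1 : ℕ) = a by push_cast; ring, Nat.cast_zero, sub_zero, ih] at h
      have h1 : q ^ (1 * ((a + 1 : ℕ) : ℤ) + 0 * b) - 1 ≠ 0 := by
        rw [sub_ne_zero, Ne, q_zpow_eq_one_iff]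
        omega
      refine (mul_eq_zero.1 ?_).resolve_left h1
      linear_combination h
  ext a b
  rw [coeff_zero, coeff_eq_zero_iff, key]

/-- A series invariant under `x ↦ q x` whose part without `x` is `1` equals `1`. -/
theorem eq_one_of_scale_x {f : SkewPowerSeries 2} (hf : scale 1 0 f = f)
    (h0 : ∀ b, coeff 0 b f = coeff 0 b (1 : SkewPowerSeries 2)) : f = 1 := by
  ext a b
  rcases Nat.eq_zero_or_pos a with rfl | ha
  · exact h0 b
  · have h := congrArg (coeff a b) hf
    rw [coeff_scale] at h
    have h1 : q ^ (1 * (a : ℤ) + 0 * b) - 1 ≠ 0 := by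
      rw [sub_ne_zero, Ne, q_zpow_eq_one_iff]
      omega
    rw [coeff_one, if_neg (by omega)]
    refine (mul_eq_zero.1 ?_).resolve_left h1
    linear_combination h

/-- A series in monomials `x^a y^b` with `b ≤ a` is determined by its diagonal part and by its
behaviour under `x ↦ q x`, `y ↦ q⁻¹ y`, which multiplies `x^a y^b` by `q^{a - b}`. -/
theorem eq_of_scale_antidiagonal (k : ℕ) {f g : SkewPowerSeries 2}
    (hf : (1 - qh ^ 3 • weylMonomial (k + 2) (k + 1)) * scale 1 (-1) f =
      (1 - qh • weylMonomial (k + 1) k) * f)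
    (hg : (1 - qh ^ 3 • weylMonomial (k + 2) (k + 1)) * scale 1 (-1) g =
      (1 - qh • weylMonomial (k + 1) k) * g)
    (hf0 : ∀ a b, a < b → coeff a b f = 0) (hg0 : ∀ a b, a < b → coeff a b g = 0)
    (h0 : ∀ a, coeff a a f = coeff a a g) : f = g := by
  rw [← sub_eq_zero]
  set d := f - g with hd
  have hd1 : scale 1 (-1) d - qh ^ 3 • (weylMonomial (k + 2) (k + 1) * scale 1 (-1) d) =
      d - qh • (weylMonomial (k + 1) k * d) := by
    have h := congrArg₂ (· - ·) hf hg
    simp only [← mul_sub, ← map_sub, ← hd] at h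
    simpa only [sub_mul, one_mul, smul_mul_assoc] using h
  have key : ∀ n : ℕ, ∀ a b : ℤ, a - b = n → weyl d a b = 0 := by
    intro n
    induction n with
    | zero =>
      intro a b hab
      obtain rfl : a = b := by simpa [sub_eq_zero] using hab
      by_cases ha : 0 ≤ a
      · lift a to ℕ using ha
        rw [← coeff_eq_zero_iff, hd, coeff_sub, h0, sub_self]
      · exact weyl_of_neg _ (by omega)
    | succ n ih =>
      intro a b hab
      have h := congrArg (weyl · a b) hd1
      simp only [weyl_scale, weyl_sub, weyl_smul, weyl_weylMonomial_mul] at h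
      rw [ih (a - (k + 2 : ℕ)) (b - (k + 1 : ℕ)) (by push_cast at hab ⊢; linarith),
        ih (a - (k + 1 : ℕ)) (b - k) (by push_cast at hab ⊢; linarith)] at h
      have h1 : q ^ (1 * a + -1 * b) - 1 ≠ 0 := by
        rw [sub_ne_zero, Ne, q_zpow_eq_one_iff]
        omega
      refine (mul_eq_zero.1 ?_).resolve_left h1
      linear_combination h
  ext a b
  rw [coeff_zero]
  rcases lt_or_ge a b with hab | hab
  · rw [hd, coeff_sub, hf0 a b hab, hg0 a b hab, sub_zero]
  · rw [coeff_eq_zero_iff]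
    exact key (a - b) a b (by omega)

/-! ### Coefficients of products -/

theorem coeff_zero_mul_of_right {f g : SkewPowerSeries 2}
    (hg : ∀ b, coeff 0 b g = coeff 0 b (1 : SkewPowerSeries 2)) (b : ℕ) :
    coeff 0 b (f * g) = coeff 0 b f := by
  conv_rhs => rw [← _root_.mul_one f]
  refine coeff_mul_congr_right f fun s hs t _ => ?_
  rw [Nat.le_zero.1 hs, hg]

theorem coeff_zero_mul_of_left {f g : SkewPowerSeries 2}
    (hf : ∀ b, coeff 0 b f = coeff 0 b (1 : SkewPowerSeries 2)) (b : ℕ) :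
    coeff 0 b (f * g) = coeff 0 b g := by
  conv_rhs => rw [← _root_.one_mul g]
  refine coeff_mul_congr_left g fun s hs t _ => ?_
  rw [Nat.le_zero.1 hs, hf]

theorem coeff_mul_eq_zero_of_lt {f g : SkewPowerSeries 2} (hf : ∀ a b, a < b → coeff a b f = 0)
    (hg : ∀ a b, a < b → coeff a b g = 0) {a b : ℕ} (hab : a < b) : coeff a b (f * g) = 0 := by
  rw [coeff_mul]
  refine Finset.sum_eq_zero fun s hs => Finset.sum_eq_zero fun t ht => ?_
  rw [Finset.HasAntidiagonal.mem_antidiagonal] at hs ht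
  rcases lt_or_ge s.1 t.1 with h | h
  · rw [hf _ _ h, zero_mul, mul_zero]
  · rw [hg s.2 t.2 (by omega), mul_zero, mul_zero]

/-- For series in monomials `x^a y^b` with `b ≤ a`, only diagonal terms contribute to the diagonal
part of a product. -/
theorem coeff_diagonal_mul {f g : SkewPowerSeries 2} (hf : ∀ a b, a < b → coeff a b f = 0)
    (hg : ∀ a b, a < b → coeff a b g = 0)
    (hg1 : ∀ a, coeff a a g = coeff a a (1 : SkewPowerSeries 2)) (a : ℕ) :
    coeff a a (f * g) = coeff a a f := by
  conv_rhs => rw [← _root_.mul_one f]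
  rw [coeff_mul, coeff_mul]
  refine Finset.sum_congr rfl fun s hs => Finset.sum_congr rfl fun t ht => ?_
  rw [Finset.HasAntidiagonal.mem_antidiagonal] at hs ht
  rcases lt_trichotomy s.2 t.2 with h | h | h
  · rw [hg _ _ h, coeff_one, if_neg (by omega)]
  · rw [← h, hg1]
  · rw [hf s.1 t.1 (by omega), zero_mul, zero_mul]

end SkewPowerSeries

open SkewPowerSeries

/-! ### The diagonal factors -/

/-- The monomial `w = q^{-1} x y`. -/
abbrev w : SkewPowerSeries 2 := weylMonomial 1 1

/-- The infinite product `∏_{i ≥ 0} (1 - q^{i + j} w)`, defined as the series given by Euler's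
formula. -/
def eulerProd (j : ℤ) : SkewPowerSeries 2 :=
  ofWeyl fun a b => if a = b then eulerCoeff a * q ^ (j * a) else 0

theorem weyl_eulerProd (j a b : ℤ) :
    weyl (eulerProd j) a b = if a = b then eulerCoeff a * q ^ (j * a) else 0 := by
  refine weyl_ofWeyl (fun a b h => ?_) a b
  split_ifs with h'
  · rw [eulerCoeff_of_neg (by omega), zero_mul]
  · rfl

theorem scale_eulerProd (j : ℤ) : scale 1 0 (eulerProd j) = eulerProd (j + 1) := by
  refine ext_weyl fun a b => ?_
  rw [weyl_scale, weyl_eulerProd, weyl_eulerProd]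
  split_ifs
  · rw [show (j + 1) * a = (1 * a + 0 * b) + j * a by ring, zpow_add₀ q_ne_zero _ (j * a),
      mul_left_comm]
  · rw [mul_zero]

theorem eulerProd_eq_mul (j : ℤ) : eulerProd j = (1 - q ^ j • w) * eulerProd (j + 1) := by
  have hq := q_ne_zero
  refine ext_weyl fun a b => ?_
  rw [sub_mul, one_mul, smul_mul_assoc, weyl_sub, weyl_smul, weyl_weylMonomial_mul]
  simp only [weyl_eulerProd, Nat.cast_one, sub_left_inj]
  split_ifs with h
  · subst h
    rw [eulerCoeff_sub_one, one_mul, sub_self, zpow_zero,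
      show (j + 1) * (a - 1) = j * a - j + a - 1 by ring, show (j + 1) * a = j * a + a by ring]
    simp only [zpow_add₀ hq, zpow_sub₀ hq, zpow_one]
    field_simp
    ring
  · ring

theorem commute_w_eulerProd (j : ℤ) : Commute w (eulerProd j) := by
  refine ext_weyl fun a b => ?_
  rw [weyl_weylMonomial_mul, weyl_mul_weylMonomial]
  simp only [weyl_eulerProd, Nat.cast_one, sub_left_inj]
  split_ifs with h
  · rw [h]
  · rw [mul_zero, mul_zero]

theorem commute_one_sub_eulerProd (c : Coef) (j : ℤ) : Commute (1 - c • w) (eulerProd j) :=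
  (Commute.one_left _).sub_left ((commute_w_eulerProd j).smul_left c)

theorem coeff_zero_eulerProd (j : ℤ) (b : ℕ) :
    coeff 0 b (eulerProd j) = coeff 0 b (1 : SkewPowerSeries 2) := by
  rw [coeff_eq_weyl, weyl_eulerProd, coeff_one, Nat.cast_zero]
  rcases Nat.eq_zero_or_pos b with rfl | hb
  · simp [eulerCoeff_zero]
  · rw [if_neg (by omega), if_neg (by omega), mul_zero]

theorem coeff_zero_Phi_weylMonomial (c : Coef) (i j b : ℕ) :
    coeff 0 b (Phi (c • weylMonomial (i + 1) j)) = coeff 0 b (1 : SkewPowerSeries 2) := by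
  rcases Nat.eq_zero_or_pos b with rfl | hb
  · rw [coeff_zero_zero_Phi, coeff_one, if_pos ⟨rfl, rfl⟩]
  · have h : c • weylMonomial (i + 1) j = monomial (i + 1) j (c * (q ^ ((i + 1) * j))⁻¹) := by
      ext a b
      rw [coeff_smul, weylMonomial, coeff_monomial, coeff_monomial]
      split_ifs <;> simp
    rw [coeff_one, if_neg (by omega), h]
    refine coeff_Phi_monomial_eq_zero _ fun n hn => ?_
    have h0 : n = 0 := by
      by_contra h0
      have : 0 < n * (i + 1) := Nat.mul_pos (Nat.pos_of_ne_zero h0) i.succ_pos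
      omega
    rw [h0, zero_mul] at hn
    omega

/-- `Φ(q^{j - 1/2} w)`. -/
abbrev diagonalPhi (j : ℤ) : SkewPowerSeries 2 := Phi ((qh ^ (2 * j - 1)) • w)

theorem scale_diagonalPhi (j : ℤ) :
    scale 1 0 (diagonalPhi j) = diagonalPhi j * (1 - q ^ j • w) ∧
      diagonalPhi j * (1 - q ^ j • w) = (1 - q ^ j • w) * diagonalPhi j := by
  have hz : coeff 0 0 ((qh ^ (2 * j - 1)) • w) = 0 := by
    rw [coeff_smul, coeff_zero_zero_weylMonomial (by omega), mul_zero]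
  have hc : q ^ j • w = qh • ((qh ^ (2 * j - 1)) • w) := by
    rw [smul_smul, ← zpow_one_add₀ qh_ne_zero, q, ← zpow_natCast, ← zpow_mul]
    congr 2
    push_cast
    ring
  rw [hc, ← Phi_q_smul' hz, ← Phi_q_smul hz, scale_Phi, scale_smul, scale_weylMonomial,
    smul_comm q]
  simp

theorem diagonalPhi_mul_eulerProd (j : ℤ) : diagonalPhi j * eulerProd j = 1 := by
  refine eq_one_of_scale_x ?_ fun b => ?_
  · rw [map_mul, (scale_diagonalPhi j).1, scale_eulerProd, _root_.mul_assoc, ← eulerProd_eq_mul]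
  · rw [coeff_zero_mul_of_left (coeff_zero_Phi_weylMonomial _ 0 1), coeff_zero_eulerProd]

theorem eulerProd_mul_diagonalPhi (j : ℤ) : eulerProd j * diagonalPhi j = 1 := by
  refine eq_one_of_scale_x ?_ fun b => ?_
  · rw [map_mul, (scale_diagonalPhi j).1, (scale_diagonalPhi j).2, scale_eulerProd,
      ← _root_.mul_assoc, ← (commute_one_sub_eulerProd _ _).eq, ← eulerProd_eq_mul]
  · rw [coeff_zero_mul_of_left (coeff_zero_eulerProd j), coeff_zero_Phi_weylMonomial _ 0 1]

theorem swap_diagonalPhi (j : ℤ) : swap (diagonalPhi j) = diagonalPhi j := by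
  rw [diagonalPhi, swap_Phi]
  change Phi ((qh ^ (2 * j - 1)) • swap w) = _
  rw [swap_weylMonomial]

theorem Phi_smul_x_mul_y (c : Coef) (j : ℤ) (h : c * q = qh ^ (2 * j - 1)) :
    Phi (c • (x 2 * y 2)) = diagonalPhi j := by
  rw [diagonalPhi, ← h, w, weylMonomial_eq_smul, smul_smul]
  simp [q_ne_zero]

theorem inverse_diagonalPhi (j : ℤ) :
    IsUnit (diagonalPhi j) ∧ Ring.inverse (diagonalPhi j) = eulerProd j :=
  let u : (SkewPowerSeries 2)ˣ :=
    ⟨diagonalPhi j, eulerProd j, diagonalPhi_mul_eulerProd j, eulerProd_mul_diagonalPhi j⟩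
  ⟨u.isUnit, Ring.inverse_unit u⟩

/-! ### The telescoping family for the right-hand product -/

/-- The series `∑_{n, m ≥ 0} c_n e_m q^m X_{n (k + 1, k) + m (1, 1)}`, where `c_n` and `e_m` are
`dilogCoeff n` and `eulerCoeff m`. Summing over `m` turns it into
`∑_n c_n X_{(k + 1, k)}^n ∏_{i ≥ 1 - n} (1 - q^i w)`. The exponent `(a, b)` corresponds to
`n = a - b` and `m = b - k (a - b)`. -/
def tailSeries (k : ℕ) : SkewPowerSeries 2 :=
  ofWeyl fun a b => dilogCoeff (a - b) * eulerCoeff (b - k * (a - b)) * q ^ (b - k * (a - b))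

theorem weyl_tailSeries (k : ℕ) (a b : ℤ) : weyl (tailSeries k) a b =
    dilogCoeff (a - b) * eulerCoeff (b - k * (a - b)) * q ^ (b - k * (a - b)) := by
  refine weyl_ofWeyl (fun a b h => ?_) a b
  by_cases h1 : a - b < 0
  · rw [dilogCoeff_of_neg h1, zero_mul, zero_mul]
  · have h2 : 0 ≤ (k : ℤ) * (a - b) := mul_nonneg (by positivity) (by omega)
    rw [eulerCoeff_of_neg (by omega), mul_zero, zero_mul]

theorem weyl_tailSeries_lattice (k : ℕ) (n m : ℤ) :
    weyl (tailSeries k) (n * (k + 1) + m) (n * k + m) =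
      dilogCoeff n * eulerCoeff m * q ^ m := by
  rw [weyl_tailSeries, show n * (k + 1) + m - (n * k + m) = n by ring,
    show n * k + m - k * n = m by ring]

/-- The vectors `(k + 1, k)` and `(1, 1)` form a basis of `ℤ × ℤ`. -/
theorem exists_lattice (k : ℕ) (a b : ℤ) :
    ∃ n m : ℤ, a = n * (k + 1) + m ∧ b = n * k + m :=
  ⟨a - b, b - k * (a - b), by ring, by ring⟩

/-- The `q`-difference equation of `tailSeries k`, which by `eq_of_scale_antidiagonal` determines
the series from its diagonal part. In Weyl-ordered coefficients it reduces, by the recursions of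
`dilogCoeff` and `eulerCoeff`, to `q^n + (1 - q^n) (1 - q^m) = 1 - q^m (1 - q^n)`. -/
theorem tailSeries_equation (k : ℕ) :
    (1 - qh ^ 3 • weylMonomial (k + 2) (k + 1)) * scale 1 (-1) (tailSeries k) =
      (1 - qh • weylMonomial (k + 1) k) * tailSeries k := by
  have hq := q_ne_zero
  have hqh := qh_ne_zero
  refine ext_weyl fun a b => ?_
  obtain ⟨n, m, rfl, rfl⟩ := exists_lattice k a b
  simp only [sub_mul, one_mul, smul_mul_assoc, weyl_sub, weyl_smul, weyl_weylMonomial_mul,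
    weyl_scale]
  push_cast
  rw [show n * (k + 1) + m - (k + 2 : ℤ) = (n - 1) * (k + 1) + (m - 1) by ring,
    show n * k + m - (k + 1 : ℤ) = (n - 1) * k + (m - 1) by ring,
    show n * (k + 1) + m - (k + 1 : ℤ) = (n - 1) * (k + 1) + m by ring,
    show n * k + m - (k : ℤ) = (n - 1) * k + m by ring]
  simp only [weyl_tailSeries_lattice, dilogCoeff_sub_one, eulerCoeff_sub_one]
  ring_nf
  simp only [zpow_add₀ hq, zpow_one, zpow_neg]
  simp only [q] at *
  field_simp
  ring

/-- As `Φ(q X_u) = (1 - q^{1/2} X_u) Φ(X_u)`, this says that `tailSeries (k + 1) * Φ(X_u)` with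
`u = (k + 1, k)` solves the `q`-difference equation of `tailSeries k`. -/
theorem tailSeries_succ_equation (k : ℕ) :
    (1 - qh ^ 3 • weylMonomial (k + 2) (k + 1)) *
        (scale 1 (-1) (tailSeries (k + 1)) * (1 - qh • weylMonomial (k + 1) k)) =
      (1 - qh • weylMonomial (k + 1) k) * tailSeries (k + 1) := by
  have hq := q_ne_zero
  have hqh := qh_ne_zero
  refine ext_weyl fun a b => ?_
  obtain ⟨n, m, rfl, rfl⟩ := exists_lattice (k + 1) a b
  simp only [sub_mul, mul_sub, one_mul, mul_one, smul_mul_assoc, mul_smul_comm, weyl_sub,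
    weyl_smul, weyl_weylMonomial_mul, weyl_mul_weylMonomial, weyl_scale]
  -- The arguments `m` and `m + 1` of `eulerCoeff` occur, and the recursion only goes down.
  obtain ⟨l, rfl⟩ : ∃ l, m = l - 1 := ⟨m + 1, by ring⟩
  push_cast
  rw [show n * (k + 1 + 1) + (l - 1) - (k + 1 : ℤ) = (n - 1) * (k + 1 + 1) + l by ring,
    show n * (k + 1) + (l - 1) - (k : ℤ) = (n - 1) * (k + 1) + l by ring,
    show n * (k + 1 + 1) + (l - 1) - (k + 2 : ℤ) = (n - 1) * (k + 1 + 1) + (l - 1) by ring,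
    show n * (k + 1) + (l - 1) - (k + 1 : ℤ) = (n - 1) * (k + 1) + (l - 1) by ring,
    show (n - 1) * (k + 1 + 1) + (l - 1) - (k + 1 : ℤ) = (n - 1 - 1) * (k + 1 + 1) + l by ring,
    show (n - 1) * (k + 1) + (l - 1) - (k : ℤ) = (n - 1 - 1) * (k + 1) + l by ring]
  have key (n m : ℤ) : weyl (tailSeries (k + 1)) (n * (k + 1 + 1) + m) (n * (k + 1) + m) =
      dilogCoeff n * eulerCoeff m * q ^ m := by
    simpa using weyl_tailSeries_lattice (k + 1) n m
  simp only [key, dilogCoeff_sub_one, eulerCoeff_sub_one]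
  ring_nf
  simp only [zpow_add₀ hq, zpow_sub₀ hq, zpow_one, zpow_neg]
  simp only [q] at *
  field_simp
  ring

/-- The telescoping relation that exhibits `tailSeries 0` as the product of all the factors
`Φ(X_{(k + 1, k)})`, up to the diagonal factor `eulerProd 1`. -/
theorem tailSeries_eq_succ_mul (k : ℕ) :
    tailSeries k = tailSeries (k + 1) * Phi (weylMonomial (k + 1) k) := by
  have hu : coeff 0 0 (weylMonomial (k + 1) k) = 0 := coeff_zero_zero_weylMonomial (by omega)
  have hN (k a b : ℕ) (h : a < b) : coeff a b (tailSeries k) = 0 := by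
    rw [coeff_eq_zero_iff, weyl_tailSeries, dilogCoeff_of_neg (by omega), zero_mul, zero_mul]
  have hP (a b : ℕ) (h : a ≤ b) (hb : b ≠ 0) : coeff a b (Phi (weylMonomial (k + 1) k)) = 0 := by
    refine coeff_Phi_monomial_eq_zero _ fun n hn => ?_
    obtain ⟨rfl, rfl⟩ := hn
    rw [mul_add, mul_one] at h
    obtain rfl : n = 0 := by omega
    simp at hb
  have hP' (a b : ℕ) (h : a < b) : coeff a b (Phi (weylMonomial (k + 1) k)) = 0 :=
    hP a b h.le (by omega)
  refine eq_of_scale_antidiagonal k (tailSeries_equation k) ?_ (hN k)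
    (fun a b h => coeff_mul_eq_zero_of_lt (hN _) hP' h) fun a => ?_
  · have hs : scale 1 (-1) (weylMonomial (k + 1) k) = q • weylMonomial (k + 1) k := by
      rw [scale_weylMonomial, show (1 * ((k + 1 : ℕ) : ℤ) + -1 * k) = 1 by push_cast; ring,
        zpow_one]
    rw [map_mul, scale_Phi, hs, Phi_q_smul hu, ← _root_.mul_assoc _ _ (Phi _),
      ← _root_.mul_assoc, tailSeries_succ_equation, _root_.mul_assoc]
  · rw [coeff_diagonal_mul (hN _) hP']
    · rw [coeff_eq_weyl, coeff_eq_weyl, weyl_tailSeries, weyl_tailSeries, sub_self, mul_zero,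
        mul_zero]
    · intro a
      rcases Nat.eq_zero_or_pos a with rfl | ha
      · rw [coeff_zero_zero_Phi, coeff_one, if_pos ⟨rfl, rfl⟩]
      · rw [hP a a le_rfl (by omega), coeff_one, if_neg (by omega)]

theorem rightPartialProd_succ (n : ℕ) :
    rightPartialProd (n + 1) = Phi (weylMonomial (n + 1) n) * rightPartialProd n := by
  rw [rightPartialProd, rightPartialProd, List.range_succ, List.reverse_append,
    List.reverse_singleton, List.singleton_append, List.map_cons, List.prod_cons,
    weylMonomial_eq_smul, mul_comm n]

theorem tailSeries_zero_eq_mul (n : ℕ) : tailSeries 0 = tailSeries n * rightPartialProd n := by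
  induction n with
  | zero => exact (_root_.mul_one _).symm
  | succ n ih =>
    rw [rightPartialProd_succ, ← _root_.mul_assoc, ← tailSeries_eq_succ_mul, ih]

theorem swap_rightPartialProd (n : ℕ) : swap (rightPartialProd n) = leftPartialProd n := by
  induction n with
  | zero => exact swap_one
  | succ n ih =>
    rw [rightPartialProd_succ, swap_mul, ih, swap_Phi, swap_weylMonomial, leftPartialProd,
      leftPartialProd, List.range_succ, List.map_append, List.prod_append, List.map_singleton,
      List.prod_singleton, weylMonomial_eq_smul, mul_comm n]

/-- In each fixed degree, only the terms of `tailSeries k` with `n = 0` survive for large `k`. -/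
theorem coeff_tailSeries_of_lt {k a b : ℕ} (h : b < k) :
    coeff a b (tailSeries k) = coeff a b (eulerProd 1) := by
  rw [coeff_eq_weyl, coeff_eq_weyl, weyl_tailSeries, weyl_eulerProd]
  congr 1
  split_ifs with hab
  · rw [hab, sub_self, mul_zero, sub_zero, dilogCoeff_zero, one_mul, one_mul]
  · rcases lt_or_gt_of_ne hab with h' | h'
    · rw [dilogCoeff_of_neg (by omega), zero_mul, zero_mul]
    · have : (k : ℤ) * 1 ≤ k * (a - b) := mul_le_mul_of_nonneg_left (by omega) (by omega)
      rw [eulerCoeff_of_neg (by omega), mul_zero, zero_mul]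

theorem tendsto_rightPartialProd :
    Tendsto rightPartialProd atTop (𝓝 (diagonalPhi 1 * tailSeries 0)) := by
  rw [tendsto_iff]
  intro a b
  filter_upwards [eventually_gt_atTop b] with n hn
  -- Up to degree `b` in `y`, the left inverse of `eulerProd 1` is one of `tailSeries n` as well.
  conv_lhs => rw [← _root_.one_mul (rightPartialProd n), ← diagonalPhi_mul_eulerProd 1,
    _root_.mul_assoc]
  rw [tailSeries_zero_eq_mul n]
  refine coeff_mul_congr_right _ fun s _ t ht => coeff_mul_congr_left _ fun s' _ t' ht' => ?_
  exact (coeff_tailSeries_of_lt (by omega)).symm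

theorem tendsto_leftPartialProd :
    Tendsto leftPartialProd atTop (𝓝 (swap (tailSeries 0) * diagonalPhi 1)) := by
  have h := tendsto_iff.1 tendsto_rightPartialProd
  rw [tendsto_iff]
  intro a b
  filter_upwards [h b a] with n hn
  rw [← swap_rightPartialProd, coeff_swap, hn, ← coeff_swap, swap_mul, swap_diagonalPhi]

/-! ### The product of the two sides -/

/-- With `swap_tailSeries_zero_scale_x`, this gives the effect of `x ↦ q x` on
`swap (tailSeries 0) * ((1 - w) * tailSeries 0)`: the factor `1 - q^{1/2} x` split off here moves
to the far left through that lemma. -/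
theorem tailSeries_zero_scale_x :
    (1 - q • w) * scale 1 0 (tailSeries 0) = (1 - qh • x 2) * tailSeries 0 := by
  have hq := q_ne_zero
  have hqh := qh_ne_zero
  have key (a b : ℤ) :
      weyl (tailSeries 0) a b = dilogCoeff (a - b) * eulerCoeff b * q ^ b := by
    simp [weyl_tailSeries]
  rw [x_eq_weylMonomial]
  refine ext_weyl fun a b => ?_
  obtain ⟨n, rfl⟩ : ∃ n, a = n + b := ⟨a - b, by ring⟩
  simp only [sub_mul, one_mul, smul_mul_assoc, weyl_sub, weyl_smul, weyl_weylMonomial_mul,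
    weyl_scale, key]
  push_cast
  rw [show n + b - b = n by ring, show n + b - 1 - (b - 1) = n by ring,
    show n + b - 1 - (b - 0) = n - 1 by ring]
  simp only [dilogCoeff_sub_one, eulerCoeff_sub_one]
  ring_nf
  simp only [zpow_add₀ hq, zpow_one, zpow_neg]
  simp only [q] at *
  field_simp
  ring

theorem swap_tailSeries_zero_scale_x :
    scale 1 0 (swap (tailSeries 0)) * (1 - qh • x 2) =
      (1 - qh • x 2) * (swap (tailSeries 0) * (1 - w)) := by
  have hq := q_ne_zero
  have hqh := qh_ne_zero
  have key (a b : ℤ) :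
      weyl (swap (tailSeries 0)) a b = dilogCoeff (b - a) * eulerCoeff a * q ^ a := by
    simp [weyl_swap, weyl_tailSeries]
  rw [x_eq_weylMonomial]
  refine ext_weyl fun a b => ?_
  -- The arguments `b - a` and `b - a + 1` of `dilogCoeff` occur, and the recursion only goes down.
  obtain ⟨l, rfl⟩ : ∃ l, b = l - 1 + a := ⟨b - a + 1, by ring⟩
  simp only [sub_mul, mul_sub, one_mul, mul_one, smul_mul_assoc, mul_smul_comm, weyl_sub,
    weyl_smul, weyl_weylMonomial_mul, weyl_mul_weylMonomial, weyl_scale, key]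
  push_cast
  rw [show l - 1 + a - a = l - 1 by ring, show l - 1 + a - 0 - (a - 1) = l by ring,
    show l - 1 + a - 1 - (a - 1) = l - 1 by ring,
    show l - 1 + a - 0 - 1 - (a - 1 - 1) = l by ring]
  simp only [dilogCoeff_sub_one, eulerCoeff_sub_one]
  ring_nf
  simp only [zpow_add₀ hq, zpow_sub₀ hq, zpow_one, zpow_neg]
  simp only [q] at *
  field_simp
  ring

/-- Both sides are multiplied on the left by `1 - q^{1/2} x` under `x ↦ q x`, and both reduce to
`Φ(y)` when the terms containing `x` are dropped. -/
theorem Phi_x_mul_Phi_y :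
    Phi (x 2) * Phi (y 2) = swap (tailSeries 0) * ((1 - w) * tailSeries 0) := by
  have hx : coeff 0 0 (x 2) = 0 := by simp [x, coeff_monomial]
  refine eq_of_scale_x ?_ ?_ fun b => ?_
  · have h1 : scale 1 0 (x 2) = q • x 2 := by
      rw [x_eq_weylMonomial, scale_weylMonomial]; simp
    have h2 : scale 1 0 (y 2) = y 2 := by
      rw [show y 2 = weylMonomial 0 1 by simp [y, weylMonomial], scale_weylMonomial]; simp
    rw [map_mul, scale_Phi, scale_Phi, h1, h2, Phi_q_smul hx, _root_.mul_assoc]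
  · have hw : scale 1 0 (1 - w) = 1 - q • w := by
      rw [map_sub, map_one, scale_weylMonomial]; simp
    rw [map_mul, map_mul, hw, tailSeries_zero_scale_x, ← _root_.mul_assoc,
      swap_tailSeries_zero_scale_x]
    simp only [_root_.mul_assoc]
  · have hN (b : ℕ) : coeff 0 b (tailSeries 0) = coeff 0 b (1 : SkewPowerSeries 2) := by
      rw [coeff_eq_weyl, weyl_tailSeries, coeff_one]
      rcases Nat.eq_zero_or_pos b with rfl | hb
      · simp [dilogCoeff_zero, eulerCoeff_zero]
      · rw [dilogCoeff_of_neg (by omega), if_neg (by omega)]; simp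
    have hw (b : ℕ) : coeff 0 b (1 - w) = coeff 0 b (1 : SkewPowerSeries 2) := by
      rw [coeff_sub, w, weylMonomial, coeff_monomial, if_neg (by omega), sub_zero]
    have hP (b : ℕ) : coeff 0 b (Phi (x 2)) = coeff 0 b (1 : SkewPowerSeries 2) := by
      simpa [x_eq_weylMonomial] using coeff_zero_Phi_weylMonomial 1 0 0 b
    rw [coeff_zero_mul_of_left hP, coeff_zero_mul_of_right, coeff_zero_Phi_y, coeff_eq_weyl,
      weyl_swap, weyl_tailSeries]
    · simp [dilogCoeff_natCast, eulerCoeff_zero]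
    · intro b
      rw [coeff_zero_mul_of_left hw, hN]

end WildDilog

end

open WildDilog WildDilog.SkewPowerSeries in
theorem mainTheorem3 :
    ∃ L R : SkewPowerSeries 2,
      Tendsto leftPartialProd atTop (𝓝 L) ∧
      Tendsto rightPartialProd atTop (𝓝 R) ∧
      IsUnit (Phi (qh⁻¹ • (x 2 * y 2))) ∧
      IsUnit (Phi ((qh ^ 3)⁻¹ • (x 2 * y 2))) ∧
      Phi (x 2) * Phi (y 2) =
        L * (Ring.inverse (Phi (qh⁻¹ • (x 2 * y 2))) *
          Ring.inverse (Phi ((qh ^ 3)⁻¹ • (x 2 * y 2)))) * R := by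
  have hqh := qh_ne_zero
  rw [Phi_smul_x_mul_y qh⁻¹ 1 (by rw [q, pow_two, inv_mul_cancel_left₀ hqh]; norm_num),
    Phi_smul_x_mul_y (qh ^ 3)⁻¹ 0 (by
      rw [q]; field_simp; norm_num; exact (mul_inv_cancel₀ hqh).symm)]
  refine ⟨_, _, tendsto_leftPartialProd, tendsto_rightPartialProd, (inverse_diagonalPhi 1).1,
    (inverse_diagonalPhi 0).1, ?_⟩
  rw [(inverse_diagonalPhi 1).2, (inverse_diagonalPhi 0).2, Phi_x_mul_Phi_y]
  -- `Φ(q^{1/2} w)` cancels one copy of `eulerProd 1` on each side, and what remains of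
  -- `eulerProd 0 = (1 - w) * eulerProd 1` is the factor `1 - w`.
  have h0 : diagonalPhi 1 * (eulerProd 1 * eulerProd 0) * diagonalPhi 1 = 1 - w := by
    rw [← mul_assoc, diagonalPhi_mul_eulerProd, one_mul, eulerProd_eq_mul, zpow_zero, one_smul,
      zero_add, mul_assoc, eulerProd_mul_diagonalPhi, mul_one]
  rw [← h0]
  simp only [mul_assoc]
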